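/- Let $E$ be a Banach lattice (a real Banach space with a lattice order compatible with the linear structure such that $\|x\|\le\|y\|$ whenever $|x|\le|y|$), and let $E_+=\{f\in E: f\ge 0\}$. A continuous valuation on $E_+$ is a norm-continuous function $W:E_+\to\mathbb R$ with $W(0)=0$ and $W(f)+W(g)=W(f\vee g)+W(f\wedge g)$ for all $f,g\in E_+$. For every continuous valuation $V:E_+\to\mathbb R$ there exist two continuous valuations $V^+,V^-:E_+\to[0,\infty)$ such that $V=V^+-V^-$. Moreover, one can take $$V^+(f)=\sup\{V(g): g\in E,\ 0\le g\le f\}\qquad (f\in E_+),$$ where this supremum is finite for every $f\in E_+$. -/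

import Mathlib

/-- The positive cone `E₊ = {f ∈ E : 0 ≤ f}` of an ordered space, with the order, the lattice
operations and the topology that it inherits from `E`. -/
abbrev PosCone (E : Type*) [Zero E] [Preorder E] : Type _ := {f : E // 0 ≤ f}

/-- A continuous valuation on the positive cone of a normed lattice: a real-valued function that is
modular for `⊔` and `⊓`, norm continuous, and zero at zero. -/
structure IsContinuousValuation {E : Type*} [NormedAddCommGroup E] [Lattice E]
    (V : PosCone E → ℝ) : Prop where
  add_eq : ∀ f g : PosCone E, V f + V g = V (f ⊔ g) + V (f ⊓ g)
  continuous : Continuous V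
  map_zero : V ⟨0, le_rfl⟩ = 0

/-! ### Disjointness and gluing in vector lattices. -/

section Lattice

variable {E : Type*} [AddCommGroup E] [Lattice E] [IsOrderedAddMonoid E]

/-! Let `P f` be the supremum of `V` over `[0, f]`. The hard half of its modularity is `V h + V k ≤
P f + P g` for `k ≤ h ≤ f ⊔ g` and `k ≤ f ⊓ g`. One would like `h = f' ⊔ g'` and `k = f' ⊓ g'` with
`f' ≤ f`, `g' ≤ g`, but a sharp cut need not exist. With `d = (h ⊓ f - h ⊓ g)⁺`, a soft cut lets
`f'` use `h ⊓ f` where `3 ^ i • d > h` and `g'` use `h ⊓ g` where `3 ^ i • d < 3 • h`. Then `f' ⊔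
g'` tends to `h` (`left_le_of_glue`, `right_le_of_glue`). The overlaps for different `i` are
disjoint, and `V` is bounded on `[0, h]`, so they cannot all push `V` below `V k` by a fixed amount
(`exists_le_apply_of_disjoint_over`). -/

theorem inf_sup_distrib_of_group (a b c : E) : a ⊓ (b ⊔ c) = (a ⊓ b) ⊔ (a ⊓ c) :=
  letI := AddCommGroup.toDistribLattice E
  inf_sup_left a b c

theorem sup_inf_distrib_of_group (a b c : E) : a ⊔ (b ⊓ c) = (a ⊔ b) ⊓ (a ⊔ c) :=
  letI := AddCommGroup.toDistribLattice E
  sup_inf_left a b c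

theorem add_inf_le_inf_add_inf {a b c : E} (ha : 0 ≤ a) (hb : 0 ≤ b) (hc : 0 ≤ c) :
    (a + b) ⊓ c ≤ a ⊓ c + b ⊓ c := by
  rw [add_inf, inf_add, inf_add]
  refine le_inf (le_inf inf_le_left (inf_le_right.trans (le_add_of_nonneg_right hb)))
    (le_inf (inf_le_right.trans (le_add_of_nonneg_left ha))
      (inf_le_right.trans (le_add_of_nonneg_right hc)))

theorem le_add_posPart_sub (a b : E) : a ≤ b + (a - b)⁺ :=
  sub_le_iff_le_add'.1 (le_posPart (a - b))

/-- The witness is the join of `k` with `x m, …, x (m + n - 1)`. Its disjointness over `k` from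
later terms carries the induction. -/
theorem apply_sup_of_disjoint_over {W : E → ℝ}
    (hm : ∀ f g, W f + W g = W (f ⊔ g) + W (f ⊓ g)) {k : E} {x : ℕ → E}
    (hx : ∀ i j, i < j → k ⊔ (x i ⊓ x j) = k) {f : E} (hkf : k ≤ f)
    (hxf : ∀ i, k ⊔ x i ≤ f) (m n : ℕ) :
    ∃ y, k ≤ y ∧ y ≤ f ∧ (∀ j, m + n ≤ j → k ⊔ (y ⊓ x j) = k) ∧
      W y - W k = ∑ i ∈ Finset.range n, (W (k ⊔ x (m + i)) - W k) := by
  induction n with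
  | zero => exact ⟨k, le_rfl, hkf, fun j _ => sup_inf_self, by simp⟩
  | succ n ih =>
    obtain ⟨y, hy, hyf, hyd, hys⟩ := ih
    refine ⟨y ⊔ x (m + n), hy.trans le_sup_left,
      sup_le hyf (le_sup_right.trans (hxf _)), fun j hj => ?_, ?_⟩
    · have h1 := hyd j (by omega)
      have h2 := hx (m + n) j (by omega)
      rw [inf_comm, inf_sup_distrib_of_group, ← sup_assoc, inf_comm, h1, inf_comm, h2]
    · have h1 := hyd (m + n) le_rfl
      have h2 := hm y (k ⊔ x (m + n))
      have h3 : y ⊓ (k ⊔ x (m + n)) = k := by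
        rw [inf_sup_distrib_of_group, inf_eq_right.2 hy, h1]
      rw [h3, ← sup_assoc, sup_eq_left.2 hy] at h2
      rw [Finset.sum_range_succ, ← hys]
      linarith

variable [Module ℝ E] [IsOrderedModule ℝ E]

theorem inf_smul_nonpos_of_inf_nonpos {p n : E} (hp : 0 ≤ p) (hn : 0 ≤ n) (h : p ⊓ n ≤ 0)
    {c : ℝ} (hc : 0 ≤ c) : p ⊓ c • n ≤ 0 := by
  -- Division by `c + 1` brings both coefficients, `1` and `c`, down to at most `1`.
  have he : 0 < c + 1 := by positivity
  have h1 : (c + 1)⁻¹ • (p ⊓ c • n) ≤ p ⊓ n := by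
    refine le_inf ?_ ?_
    · calc (c + 1)⁻¹ • (p ⊓ c • n) ≤ (c + 1)⁻¹ • p :=
          smul_le_smul_of_nonneg_left inf_le_left (by positivity)
        _ ≤ (1 : ℝ) • p := smul_le_smul_of_nonneg_right (inv_le_one_of_one_le₀ (by linarith)) hp
        _ = p := one_smul _ _
    · calc (c + 1)⁻¹ • (p ⊓ c • n) ≤ (c + 1)⁻¹ • c • n :=
          smul_le_smul_of_nonneg_left inf_le_right (by positivity)
        _ = ((c + 1)⁻¹ * c) • n := smul_smul _ _ _
        _ ≤ (1 : ℝ) • n := smul_le_smul_of_nonneg_right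
          ((inv_mul_le_one₀ he).2 (by linarith)) hn
        _ = n := one_smul _ _
  have h2 := smul_le_smul_of_nonneg_left (h1.trans h) he.le
  rwa [smul_inv_smul₀ he.ne', smul_zero] at h2

theorem posPart_inf_posPart_nonpos {a b : E} {c : ℝ} (hc : 0 ≤ c) (h : b ≤ -(c • a)) :
    a⁺ ⊓ b⁺ ≤ 0 := by
  have hb : b⁺ ≤ c • a⁻ := by
    rw [posPart_def]
    refine sup_le (h.trans ?_) (smul_nonneg hc (negPart_nonneg a))
    rw [← smul_neg]
    exact smul_le_smul_of_nonneg_left (neg_le_negPart a) hc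
  exact (inf_le_inf_left _ hb).trans (inf_smul_nonpos_of_inf_nonpos (posPart_nonneg a)
    (negPart_nonneg a) (posPart_inf_negPart_eq_zero a).le hc)

/-- The mean of `v - u` and `3 • u - v` is `u`. -/
theorem le_posPart_sup_posPart (u v : E) : u ≤ (v - u)⁺ ⊔ (3 • u - v)⁺ := by
  set M := (v - u)⁺ ⊔ (3 • u - v)⁺
  have h1 : v - u ≤ M := (le_posPart _).trans le_sup_left
  have h2 : 3 • u - v ≤ M := (le_posPart _).trans le_sup_right
  have h3 : (2⁻¹ : ℝ) • ((v - u) + (3 • u - v)) ≤ (2⁻¹ : ℝ) • (M + M) :=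
    smul_le_smul_of_nonneg_left (add_le_add h1 h2) (by norm_num)
  convert h3 using 1 <;> module

variable {h₁ h₂ u X : E} {c : ℝ}

theorem right_le_of_glue (hh₁ : 0 ≤ h₁) (hu₂ : h₂ ≤ u) (hu : 0 ≤ u) (hc : 0 ≤ c)
    (hA : h₁ ⊓ (c • (h₁ - h₂)⁺ - u)⁺ ≤ X) (hB : h₂ ⊓ (3 • u - c • (h₁ - h₂)⁺)⁺ ≤ X) :
    h₂ ≤ X := by
  have h := hu₂.trans (le_posPart_sup_posPart u (c • (h₁ - h₂)⁺))
  rw [← inf_eq_left.2 h, inf_sup_distrib_of_group]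
  refine sup_le (le_trans ?_ hA) hB
  refine le_inf ?_ inf_le_right |>.trans (le_inf inf_le_left inf_le_right)
  set A := (c • (h₁ - h₂)⁺ - u)⁺
  have hA0 : 0 ≤ A := posPart_nonneg _
  have hA' : A ≤ c • (h₁ - h₂)⁺ := by
    refine sup_le (sub_le_self _ hu) (smul_nonneg hc (posPart_nonneg _))
  -- `A` lives where `h₁ > h₂`, so there `h₂` may be replaced by `h₁`.
  have hz : (h₂ - h₁)⁺ ⊓ A ≤ 0 := by
    refine (inf_le_inf_left _ hA').trans (inf_smul_nonpos_of_inf_nonpos (posPart_nonneg _)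
      (posPart_nonneg _) (posPart_inf_posPart_nonpos zero_le_one ?_) hc)
    simp
  calc h₂ ⊓ A ≤ (h₁ + (h₂ - h₁)⁺) ⊓ A := inf_le_inf_right _ (le_add_posPart_sub _ _)
    _ ≤ h₁ ⊓ A + (h₂ - h₁)⁺ ⊓ A := add_inf_le_inf_add_inf hh₁ (posPart_nonneg _) hA0
    _ ≤ h₁ ⊓ A + 0 := by gcongr
    _ ≤ h₁ := by rw [add_zero]; exact inf_le_left

/-- Where `c • d ≤ 2 • u`, `h₁ ≤ h₂ + d` costs at most `(2 / c) • u`; elsewhere `c • d - u ≥ u ≥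
h₁`, so the cut leaves `h₁` intact. The disjoint errors `p` and `n` encode the two regions. -/
theorem left_le_of_glue (hh₁ : 0 ≤ h₁) (hu₁ : h₁ ≤ u) (hu₂ : h₂ ≤ u) (hc : 1 ≤ c)
    (hA : h₁ ⊓ (c • (h₁ - h₂)⁺ - u)⁺ ≤ X) (hB : h₂ ⊓ (3 • u - c • (h₁ - h₂)⁺)⁺ ≤ X) :
    h₁ ≤ X + (2 / c) • u := by
  have hc0 : 0 < c := by linarith
  have hu : 0 ≤ u := hh₁.trans hu₁
  have hX := right_le_of_glue hh₁ hu₂ hu hc0.le hA hB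
  set d := (h₁ - h₂)⁺ with hd
  set p := (c • d - (2 : ℝ) • u)⁺ with hp
  set n := ((2 : ℝ) • u - c • d)⁺ with hn
  have hpn : p ⊓ n ≤ 0 := posPart_inf_posPart_nonpos zero_le_one (by simp)
  have h1 : h₁ ≤ X + (2 / c) • u + p := by
    have hdp : d ≤ (2 / c) • u + p := by
      have := smul_le_smul_of_nonneg_left (le_add_posPart_sub (c • d) ((2 : ℝ) • u))
        (inv_nonneg.2 hc0.le)
      rw [inv_smul_smul₀ hc0.ne', smul_add, smul_smul, ← hp, inv_mul_eq_div] at this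
      refine this.trans (add_le_add_right ?_ _)
      calc c⁻¹ • p ≤ (1 : ℝ) • p :=
            smul_le_smul_of_nonneg_right (inv_le_one_of_one_le₀ hc) (posPart_nonneg _)
        _ = p := one_smul _ _
    rw [add_assoc]
    exact (le_add_posPart_sub h₁ h₂).trans (add_le_add hX hdp)
  have h2 : h₁ ≤ X + (2 / c) • u + n := by
    have h3 : h₁ ≤ X + n := by
      have h4 : h₁ - h₁ ⊓ (c • d - u)⁺ ≤ n := by
        rw [sub_inf, sub_self]
        refine sup_le (posPart_nonneg _) (le_trans ?_ (le_posPart _))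
        calc h₁ - (c • d - u)⁺ ≤ u - (c • d - u) := sub_le_sub hu₁ (le_posPart _)
          _ = (2 : ℝ) • u - c • d := by module
      exact (sub_le_iff_le_add'.1 h4).trans (by gcongr)
    rw [add_right_comm]
    exact h3.trans (le_add_of_nonneg_right (smul_nonneg (by positivity) hu))
  calc h₁ ≤ (X + (2 / c) • u + p) ⊓ (X + (2 / c) • u + n) := le_inf h1 h2
    _ = X + (2 / c) • u + p ⊓ n := (add_inf _ _ _).symm
    _ ≤ X + (2 / c) • u + 0 := by gcongr
    _ = X + (2 / c) • u := add_zero _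

end Lattice

/-! ### Continuous modular functions: boundedness and the key inequality. -/

section Modular

variable {E : Type*} [NormedAddCommGroup E] [NormedSpace ℝ E]
    [Lattice E] [IsOrderedAddMonoid E] [IsOrderedModule ℝ E] [HasSolidNorm E]

/-- The bound is carried along the compact segment from `0` to `f` in `n` short steps: `W g = W (g ⊔
a) + W (g ⊓ a) - W a`, where `g ⊔ a` is close to the segment point `a` and `g ⊓ a ≤ a`. -/
theorem exists_abs_le_on_Icc {W : E → ℝ} (hc : Continuous W)
    (hm : ∀ f g, W f + W g = W (f ⊔ g) + W (f ⊓ g)) {f : E} (hf : 0 ≤ f) :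
    ∃ C, ∀ g ∈ Set.Icc 0 f, |W g| ≤ C := by
  have hK : IsCompact ((fun t : ℝ => t • f) '' Set.Icc 0 1) :=
    isCompact_Icc.image (by fun_prop)
  obtain ⟨C, hC⟩ := (hK.image hc).isBounded.exists_norm_le
  have hC' : ∀ t ∈ Set.Icc (0 : ℝ) 1, |W (t • f)| ≤ C := fun t ht =>
    hC _ ⟨_, ⟨t, ht, rfl⟩, rfl⟩
  have hu := hK.uniformContinuousAt_of_continuousAt W (fun a _ => hc.continuousAt)
    (Metric.dist_mem_uniformity one_pos)
  obtain ⟨ε, hε, hε'⟩ := Metric.mem_uniformity_dist.1 hu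
  obtain ⟨n, hn⟩ := exists_nat_gt (‖f‖ / ε)
  have hn0 : (0 : ℝ) < n := lt_of_le_of_lt (by positivity) hn
  have key : ∀ i : ℕ, i ≤ n →
      ∃ D, ∀ g ∈ Set.Icc 0 (((i : ℝ) / n) • f), |W g| ≤ D := by
    intro i
    induction i with
    | zero =>
      refine fun _ => ⟨|W 0|, fun g hg => ?_⟩
      have : g = 0 := le_antisymm (by simpa using hg.2) hg.1
      rw [this]
    | succ i ih =>
      intro hi
      obtain ⟨D, hD⟩ := ih (by omega)
      have hin : (i : ℝ) / n ∈ Set.Icc (0 : ℝ) 1 :=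
        ⟨by positivity, (div_le_one hn0).2 (by exact_mod_cast (by omega : i ≤ n))⟩
      set a : E := ((i : ℝ) / n) • f with ha
      have ha0 : 0 ≤ a := smul_nonneg hin.1 hf
      refine ⟨C + 1 + D + C, fun g hg => ?_⟩
      have h1 := hC' _ hin
      have h2 := hD (g ⊓ a) ⟨le_inf hg.1 ha0, inf_le_right⟩
      have hsucc : (((i + 1 : ℕ) : ℝ) / n) • f = a + (1 / n : ℝ) • f := by
        rw [ha, ← add_smul]; push_cast; ring_nf
      have h3 : ‖g ⊔ a - a‖ ≤ ‖(1 / n : ℝ) • f‖ := by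
        have hnn : 0 ≤ (1 / n : ℝ) • f := smul_nonneg (by positivity) hf
        apply norm_le_norm_of_abs_le_abs
        rw [abs_of_nonneg (sub_nonneg.2 le_sup_right), abs_of_nonneg hnn, sub_le_iff_le_add']
        exact sup_le (hsucc ▸ hg.2) (le_add_of_nonneg_right hnn)
      have h4 : dist a (g ⊔ a) < ε := by
        rw [dist_comm, dist_eq_norm]
        refine h3.trans_lt ?_
        rw [norm_smul, Real.norm_of_nonneg (by positivity), one_div, inv_mul_lt_iff₀ hn0]
        rwa [div_lt_iff₀ hε] at hn
      have h5 : dist (W a) (W (g ⊔ a)) < 1 := hε' h4 ⟨_, hin, rfl⟩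
      rw [Real.dist_eq] at h5
      have := hm g a
      rw [abs_le] at h1 h2 ⊢
      rw [abs_lt] at h5
      constructor <;> linarith
  have := key n le_rfl
  rwa [div_self hn0.ne', one_smul] at this

/-- Otherwise joining `n` of the terms to `k` would lower `W` by more than `n * ε`, against its
boundedness on `[0, f]`. -/
theorem exists_le_apply_of_disjoint_over {W : E → ℝ} (hc : Continuous W)
    (hm : ∀ f g, W f + W g = W (f ⊔ g) + W (f ⊓ g)) {k : E} (hk : 0 ≤ k) {x : ℕ → E}
    (hx : ∀ i j, i < j → k ⊔ (x i ⊓ x j) = k) {f : E}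
    (hxf : ∀ i, k ⊔ x i ≤ f) {ε : ℝ} (hε : 0 < ε) (m : ℕ) :
    ∃ i ≥ m, W k - ε ≤ W (k ⊔ x i) := by
  have hkf : k ≤ f := le_sup_left.trans (hxf 0)
  obtain ⟨C, hC⟩ := exists_abs_le_on_Icc hc hm (hk.trans hkf)
  by_contra! hcon
  obtain ⟨n, hn⟩ := exists_nat_gt (2 * C / ε)
  rw [div_lt_iff₀ hε] at hn
  obtain ⟨y, hy, hyf, -, hs⟩ := apply_sup_of_disjoint_over hm hx hkf hxf m n
  have h1 := abs_le.1 (hC y ⟨hk.trans hy, hyf⟩)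
  have h2 := abs_le.1 (hC k ⟨hk, hkf⟩)
  have h3 : ∑ i ∈ Finset.range n, (W (k ⊔ x (m + i)) - W k) ≤
      ∑ i ∈ Finset.range n, (-ε) :=
    Finset.sum_le_sum fun i _ => by linarith [hcon (m + i) (by omega)]
  simp only [Finset.sum_const, Finset.card_range, nsmul_eq_mul] at h3
  linarith


open Filter Topology in
theorem add_le_add_of_le_sup_of_le_inf {W : E → ℝ} (hc : Continuous W)
    (hm : ∀ f g, W f + W g = W (f ⊔ g) + W (f ⊓ g)) {f g h k : E} {a b : ℝ}
    (ha : ∀ x ∈ Set.Icc 0 f, W x ≤ a) (hb : ∀ x ∈ Set.Icc 0 g, W x ≤ b)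
    (hk : 0 ≤ k) (hkh : k ≤ h) (hkm : k ≤ f ⊓ g) (hh : h ≤ f ⊔ g) : W h + W k ≤ a + b := by
  have hkf : k ≤ f := hkm.trans inf_le_left
  have hkg : k ≤ g := hkm.trans inf_le_right
  set h₁ := h ⊓ f with hh₁
  set h₂ := h ⊓ g with hh₂
  have hk₁ : k ≤ h₁ := le_inf hkh hkf
  have hk₂ : k ≤ h₂ := le_inf hkh hkg
  have hh0 : 0 ≤ h := hk.trans hkh
  have hsup : h₁ ⊔ h₂ = h := by rw [hh₁, hh₂, ← inf_sup_distrib_of_group, inf_eq_left.2 hh]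
  set c : ℕ → ℝ := fun i => 3 ^ i
  have hc1 : ∀ i, 1 ≤ c i := fun i => one_le_pow₀ (by norm_num)
  have hc0 : ∀ i, 0 ≤ c i := fun i => zero_le_one.trans (hc1 i)
  set d := (h₁ - h₂)⁺
  have hd : 0 ≤ d := posPart_nonneg _
  set A : ℕ → E := fun i => (c i • d - h)⁺ with hA
  set B : ℕ → E := fun i => (3 • h - c i • d)⁺ with hB
  set x : ℕ → E := fun i => (h₁ ⊓ A i) ⊓ (h₂ ⊓ B i) with hx
  set X : ℕ → E := fun i => (k ⊔ (h₁ ⊓ A i)) ⊔ (k ⊔ (h₂ ⊓ B i)) with hX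
  have hXh : ∀ i, X i ≤ h := fun i => sup_le (sup_le hkh (inf_le_left.trans inf_le_left))
    (sup_le hkh (inf_le_left.trans inf_le_left))
  have hhX : ∀ i, h ≤ X i + (2 / c i) • h := by
    intro i
    have h1 : h₁ ⊓ A i ≤ X i := le_sup_right.trans le_sup_left
    have h2 : h₂ ⊓ B i ≤ X i := le_sup_right.trans le_sup_right
    rw [← hsup]
    refine sup_le ?_ ?_ <;> rw [hsup]
    · exact left_le_of_glue (hk.trans hk₁) inf_le_left inf_le_left (hc1 i) h1 h2
    · exact (right_le_of_glue (hk.trans hk₁) inf_le_left hh0 (hc0 i) h1 h2).trans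
        (le_add_of_nonneg_right (smul_nonneg (div_nonneg zero_le_two (hc0 i)) hh0))
  have hlim : Tendsto X atTop (𝓝 h) := by
    rw [tendsto_iff_norm_sub_tendsto_zero]
    have hz : Tendsto (fun i => 2 / c i * ‖h‖) atTop (𝓝 0) := by
      rw [← zero_mul ‖h‖]
      exact ((tendsto_pow_atTop_atTop_of_one_lt (by norm_num : (1 : ℝ) < 3)).const_div_atTop
        2).mul_const _
    refine squeeze_zero (fun _ => norm_nonneg _) (fun i => ?_) hz
    have hs : 0 ≤ 2 / c i := div_nonneg zero_le_two (hc0 i)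
    rw [norm_sub_rev, ← Real.norm_of_nonneg hs, ← norm_smul]
    apply norm_le_norm_of_abs_le_abs
    rw [abs_of_nonneg (sub_nonneg.2 (hXh i)), abs_of_nonneg (smul_nonneg hs hh0)]
    exact sub_le_iff_le_add'.2 (hhX i)
  have hdis : ∀ i j, i < j → k ⊔ (x i ⊓ x j) = k := by
    intro i j hij
    refine sup_eq_left.2 (le_trans ?_ hk)
    have h1 : x i ⊓ x j ≤ A i ⊓ B j := le_inf
      (inf_le_left.trans (inf_le_left.trans inf_le_right))
      (inf_le_right.trans (inf_le_right.trans inf_le_right))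
    refine h1.trans (posPart_inf_posPart_nonpos (c := 3) (by norm_num) ?_)
    -- The ratio of successive scales matches the `3` in `B`, so `B j` vanishes where `A i` is
    -- positive.
    have h2 : 3 * c i ≤ c j := by
      calc 3 * c i = 3 ^ (i + 1) := (pow_succ' _ _).symm
        _ ≤ 3 ^ j := pow_le_pow_right₀ (by norm_num) hij
    calc 3 • h - c j • d ≤ 3 • h - (3 * c i) • d := by gcongr
      _ = -((3 : ℝ) • (c i • d - h)) := by module
  refine le_of_forall_pos_le_add fun ε hε => ?_
  have hev : ∀ᶠ i in atTop, W h - ε / 2 < W (X i) :=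
    ((hc.tendsto h).comp hlim).eventually_const_lt (by linarith)
  obtain ⟨m, hm'⟩ := eventually_atTop.1 hev
  obtain ⟨i, hi, hki⟩ := exists_le_apply_of_disjoint_over hc hm hk hdis (f := h)
    (fun i => sup_le hkh (inf_le_left.trans (inf_le_left.trans inf_le_left))) (half_pos hε) m
  have h1 := hm' i hi
  have h2 := hm (k ⊔ (h₁ ⊓ A i)) (k ⊔ (h₂ ⊓ B i))
  rw [← sup_inf_distrib_of_group] at h2
  have h3 := ha (k ⊔ (h₁ ⊓ A i))
    ⟨hk.trans le_sup_left, sup_le hkf (inf_le_left.trans inf_le_right)⟩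
  have h4 := hb (k ⊔ (h₂ ⊓ B i))
    ⟨hk.trans le_sup_left, sup_le hkg (inf_le_left.trans inf_le_right)⟩
  linarith

end Modular

/-! ### The decomposition. -/

theorem theoremt {E : Type*} [NormedAddCommGroup E] [NormedSpace ℝ E] [CompleteSpace E]
    [Lattice E] [IsOrderedAddMonoid E] [IsOrderedModule ℝ E] [HasSolidNorm E]
    (V : PosCone E → ℝ) (hV : IsContinuousValuation V) :
    ∃ Vp Vm : PosCone E → ℝ,
      IsContinuousValuation Vp ∧ IsContinuousValuation Vm ∧
      (∀ f, 0 ≤ Vp f) ∧ (∀ f, 0 ≤ Vm f) ∧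
      (∀ f, V f = Vp f - Vm f) ∧
      (∀ f, IsLUB {r : ℝ | ∃ g : PosCone E, g ≤ f ∧ r = V g} (Vp f)) := by
  -- Composition with the positive part, a continuous lattice homomorphism, extends `V` to all of
  -- `E`.
  set W : E → ℝ := fun x => V ⟨x⁺, posPart_nonneg x⟩ with hWdef
  have hVW : ∀ f : PosCone E, V f = W f := fun f => by
    simp only [hWdef, posPart_of_nonneg f.2]
  have hW : Continuous W := hV.continuous.comp
    ((continuous_id.sup continuous_const).subtype_mk _)
  have hm : ∀ f g, W f + W g = W (f ⊔ g) + W (f ⊓ g) := fun f g => by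
    have h := hV.add_eq ⟨f⁺, posPart_nonneg f⟩ ⟨g⁺, posPart_nonneg g⟩
    have h1 : (f ⊔ g)⁺ = f⁺ ⊔ g⁺ := by
      simp only [posPart_def]; exact sup_sup_distrib_right _ _ _
    have h2 : (f ⊓ g)⁺ = f⁺ ⊓ g⁺ := by
      simp only [posPart_def, sup_comm _ (0 : E)]
      exact sup_inf_distrib_of_group _ _ _
    simp only [hWdef, h1, h2]
    exact h
  set S : PosCone E → Set ℝ := fun f => {r : ℝ | ∃ g : PosCone E, g ≤ f ∧ r = V g} with hS
  set P : PosCone E → ℝ := fun f => sSup (S f) with hP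
  have hlub : ∀ f, IsLUB (S f) (P f) := fun f => by
    refine isLUB_csSup ⟨V f, f, le_rfl, rfl⟩ ?_
    obtain ⟨C, hC⟩ := exists_abs_le_on_Icc hW hm f.2
    refine ⟨C, ?_⟩
    rintro _ ⟨g, hg, rfl⟩
    rw [hVW]
    exact (le_abs_self _).trans (hC g ⟨g.2, hg⟩)
  have hle : ∀ f g : PosCone E, g ≤ f → V g ≤ P f := fun f g hg => (hlub f).1 ⟨g, hg, rfl⟩
  have hleW : ∀ f : PosCone E, ∀ x ∈ Set.Icc 0 (f : E), W x ≤ P f := fun f x hx => by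
    have := hle f ⟨x, hx.1⟩ hx.2
    rwa [hVW] at this
  have happrox : ∀ (f : PosCone E) {ε : ℝ}, 0 < ε → ∃ g ≤ f, P f - ε < V g := fun f ε hε => by
    obtain ⟨_, ⟨g, hg, rfl⟩, h, -⟩ := (hlub f).exists_between (sub_lt_self (P f) hε)
    exact ⟨g, hg, h⟩
  have hPadd : ∀ f g, P f + P g = P (f ⊔ g) + P (f ⊓ g) := by
    intro f g
    refine le_antisymm ?_ ?_ <;> refine le_of_forall_pos_le_add fun ε hε => ?_
    · obtain ⟨x, hx, hx'⟩ := happrox f (half_pos hε)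
      obtain ⟨y, hy, hy'⟩ := happrox g (half_pos hε)
      have h1 := hV.add_eq x y
      have h2 := hle (f ⊔ g) (x ⊔ y) (sup_le_sup hx hy)
      have h3 := hle (f ⊓ g) (x ⊓ y) (inf_le_inf hx hy)
      linarith
    · obtain ⟨h, hh, hh'⟩ := happrox (f ⊔ g) (half_pos hε)
      obtain ⟨k, hk, hk'⟩ := happrox (f ⊓ g) (half_pos hε)
      have h1 := hV.add_eq h k
      -- Passing to `h ⊔ k` and `h ⊓ k` keeps the sum of values and makes the pair nested.
      have h2 : W (h ⊔ k : PosCone E) + W (h ⊓ k : PosCone E) ≤ P f + P g :=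
        add_le_add_of_le_sup_of_le_inf hW hm (hleW f) (hleW g) (h ⊓ k).2
          (inf_le_left.trans le_sup_left) (inf_le_right.trans hk)
          (sup_le hh (hk.trans (inf_le_left.trans le_sup_left)))
      rw [← hVW, ← hVW] at h2
      linarith
  have hPc : Continuous P := by
    rw [continuous_iff_continuousAt]
    intro f
    rw [ContinuousAt, Metric.tendsto_nhds]
    intro ε hε
    obtain ⟨g, hg, hg'⟩ := happrox f hε
    have hlow : ∀ᶠ f' : PosCone E in nhds f, P f - ε < W ((g : E) ⊓ f') := by
      have : Continuous fun f' : PosCone E => W ((g : E) ⊓ f') :=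
        hW.comp (continuous_const.inf continuous_subtype_val)
      refine (this.tendsto f).eventually_const_lt ?_
      rwa [inf_eq_left.2 (show (g : E) ≤ f from hg), ← hVW]
    obtain ⟨δ, hδ, hδ'⟩ := Metric.continuousAt_iff.1 (hW.continuousAt (x := (f : E))) (ε / 2)
      (half_pos hε)
    filter_upwards [hlow, Metric.ball_mem_nhds f hδ] with f' h1 h2
    have h3 : P f - ε < P f' := h1.trans_le
      (hleW f' _ ⟨le_inf g.2 f'.2, inf_le_right⟩)
    -- For `x ≤ f'`, `W x = W (x ⊔ f) - W f + W (x ⊓ f)`: the difference is small since `x ⊔ f` is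
    -- as close to `f` as `f'` is, and the last term is at most `P f`.
    have h4 : P f' ≤ P f + ε / 2 := by
      refine (hlub f').2 ?_
      rintro _ ⟨x, hx, rfl⟩
      have h5 : dist ((x : E) ⊔ f) f < δ := by
        refine lt_of_le_of_lt ?_ (show dist (f' : E) f < δ from h2)
        rw [dist_eq_norm, dist_eq_norm]
        apply norm_le_norm_of_abs_le_abs
        rw [abs_of_nonneg (sub_nonneg.2 le_sup_right), sub_le_iff_le_add']
        exact sup_le ((show (x : E) ≤ f' from hx).trans
          (sub_le_iff_le_add'.1 (le_abs_self _))) (le_add_of_nonneg_right (abs_nonneg _))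
      have h6 := hδ' h5
      rw [Real.dist_eq, abs_lt] at h6
      have h7 := hm x f
      have h8 := hleW f ((x : E) ⊓ f) ⟨le_inf x.2 f.2, inf_le_right⟩
      rw [hVW]
      linarith
    rw [Real.dist_eq, abs_lt]
    constructor <;> linarith
  have hP0 : P ⟨0, le_rfl⟩ = 0 := by
    refine le_antisymm ((hlub _).2 ?_) ?_
    · rintro _ ⟨g, hg, rfl⟩
      rw [le_antisymm hg g.2, hV.map_zero]
    · rw [← hV.map_zero]
      exact hle _ _ le_rfl
  refine ⟨P, fun f => P f - V f, ⟨hPadd, hPc, hP0⟩, ⟨fun f g => ?_, hPc.sub hV.continuous, ?_⟩,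
    fun f => ?_, fun f => sub_nonneg.2 (hle f f le_rfl), fun f => by ring, hlub⟩
  · linarith [hPadd f g, hV.add_eq f g]
  · rw [hP0, hV.map_zero, sub_zero]
  · rw [← hV.map_zero]
    exact hle f _ f.2
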